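/- All graphs are simple, and $G$ \emph{contains} $F$ if $F$ is isomorphic to an induced subgraph of $G$. A \emph{hole} is a chordless cycle of length at least $4$, an \emph{antihole} is the complement of a hole, and a graph is \emph{Berge} if it contains no odd hole and no odd antihole. A \emph{prism} consists of two vertex-disjoint triangles $\{a_1,a_2,a_3\}$, $\{b_1,b_2,b_3\}$ and three pairwise vertex-disjoint paths $R_i$ from $a_i$ to $b_i$ $(i=1,2,3)$, with no edges other than those of the triangles and of the paths; it is \emph{even} if the three paths have even length. A vertex outside a prism is a \emph{major neighbour} of it if it has at least two neighbours in $\{a_1,a_2,a_3\}$ and at least two neighbours in $\{b_1,b_2,b_3\}$. A \emph{hyperprism} is a graph $H$ whose vertex set can be partitioned into nine sets $A_i, C_i, B_i$ ($i=1,2,3$; the sets $C_i$ may be empty) such that: the sets $A_i$ and $B_i$ are non-empty; for distinct $i,j$, $A_i$ is complete to $A_j$, $B_i$ is complete to $B_j$, and there are no other edges between $A_i\cup B_i\cup C_i$ and $A_j\cup B_j\cup C_j$; and for each $i$, every vertex of $A_i\cup B_i\cup C_i$ belongs to an \emph{$i$-rung}, that is, a chordless path with one end in $A_i$, the other end in $B_i$,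 and interior in $C_i$. The hyperprism (with this partition) is \emph{even} if all its rungs have even length. Any choice of one $i$-rung for each $i\in\{1,2,3\}$ forms a prism, called an \emph{instance} of $H$. If $H$ is an induced subgraph of $G$, a vertex $x\in V(G)\setminus V(H)$ is a \emph{major neighbour} of $H$ if it is a major neighbour of some instance of $H$. \textbf{Theorem.} Let $G$ be a Berge graph that contains an even prism and does not contain the line graph of any bipartite subdivision of $K_4$. Let $H$ be an induced subgraph of $G$ that is an even hyperprism, with partition $(A_1,\ldots,B_3)$ as above, and let $x$ be a major neighbour of $H$. Then either (i) $x$ is complete to at least two of $A_1,A_2,A_3$ and to at least two of $B_1,B_2,B_3$, or (ii) $V(H)\cup\{x\}$ induces a hyperprism in $G$ (for some partition into nine sets as in the definition). -/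

import Mathlib

open SimpleGraph

namespace EvenHyperprism

/-- `G` contains an odd hole: a chordless cycle of odd length at least four
(as an induced subgraph). -/
def ContainsOddHole {V : Type*} (G : SimpleGraph V) : Prop :=
  ∃ k : ℕ, 4 ≤ k ∧ Odd k ∧ (cycleGraph k).IsIndContained G

/-- `G` contains an odd antihole: the complement of an odd hole (as an induced subgraph). -/
def ContainsOddAntihole {V : Type*} (G : SimpleGraph V) : Prop :=
  ∃ k : ℕ, 4 ≤ k ∧ Odd k ∧ (cycleGraph k)ᶜ.IsIndContained G

/-- A Berge graph contains no odd hole and no odd antihole. -/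
def IsBerge {V : Type*} (G : SimpleGraph V) : Prop :=
  ¬ ContainsOddHole G ∧ ¬ ContainsOddAntihole G

/-- A way of seeing `H` as a subdivision of `J`: the vertices of `J` are vertices of `H`
(through `f`), and each edge `uv` of `J` is replaced by a path `P u v` of `H` from `f u` to `f v`
(the same path, reversed, when the edge is read as `vu`). Paths of different edges meet only in
branch vertices, a path contains no branch vertex besides its ends, and `H` has no other vertices
and no other edges. -/
structure SubdivisionModel {U W : Type*} (J : SimpleGraph U) (H : SimpleGraph W) where
  f : U ↪ W
  P : ∀ u v : U, J.Adj u v → H.Walk (f u) (f v)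
  isPath : ∀ u v (h : J.Adj u v), (P u v h).IsPath
  reverse : ∀ u v (h : J.Adj u v), P v u h.symm = (P u v h).reverse
  branch : ∀ u v (h : J.Adj u v) (w : U), f w ∈ (P u v h).support → w = u ∨ w = v
  disjoint : ∀ u v (h : J.Adj u v) u' v' (h' : J.Adj u' v'), s(u, v) ≠ s(u', v') →
    ∀ z, z ∈ (P u v h).support → z ∈ (P u' v' h').support → z ∈ Set.range f
  covers_verts : ∀ z : W, z ∈ Set.range f ∨ ∃ u v, ∃ h : J.Adj u v, z ∈ (P u v h).support
  covers_edges : ∀ e ∈ H.edgeSet, ∃ u v, ∃ h : J.Adj u v, e ∈ (P u v h).edges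

/-- `H` is a subdivision of `J`. -/
def IsSubdivision {U W : Type*} (J : SimpleGraph U) (H : SimpleGraph W) : Prop :=
  Nonempty (SubdivisionModel J H)

/-- `G` contains (as an induced subgraph) the line graph of a bipartite subdivision of `K₄`. -/
def ContainsLineGraphOfBipartiteSubdivisionK4 {V : Type*} (G : SimpleGraph V) : Prop :=
  ∃ (W : Type) (H : SimpleGraph W), IsSubdivision (completeGraph (Fin 4)) H ∧ H.IsBipartite ∧
    H.lineGraph.IsIndContained G

/-- A chordless path. -/
def IsChordlessPath {V : Type*} {G : SimpleGraph V} {u v : V} (p : G.Walk u v) : Prop :=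
  p.IsPath ∧ p.IsChordless

/-- The paths `R 0`, `R 1`, `R 2` form a prism in `G`, that is, their union induces a prism with
triangles `{a 0, a 1, a 2}` and `{b 0, b 1, b 2}`. -/
structure IsPrism {V : Type*} (G : SimpleGraph V) {a b : Fin 3 → V}
    (R : ∀ i, G.Walk (a i) (b i)) : Prop where
  chordless : ∀ i, IsChordlessPath (R i)
  ends_ne : ∀ i, a i ≠ b i
  disjoint : ∀ i j, i ≠ j → ∀ v ∈ (R i).support, v ∉ (R j).support
  adj_a : ∀ i j, i ≠ j → G.Adj (a i) (a j)
  adj_b : ∀ i j, i ≠ j → G.Adj (b i) (b j)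
  only : ∀ i j, i ≠ j → ∀ u ∈ (R i).support, ∀ v ∈ (R j).support, G.Adj u v →
    (u = a i ∧ v = a j) ∨ (u = b i ∧ v = b j)

/-- `G` contains (as an induced subgraph) a prism whose three paths all have even length. -/
def ContainsEvenPrism {V : Type*} (G : SimpleGraph V) : Prop :=
  ∃ (a b : Fin 3 → V) (R : ∀ i, G.Walk (a i) (b i)), IsPrism G R ∧ ∀ i, Even (R i).length

/-- `x` is a major neighbour of the prism formed by `R 0`, `R 1`, `R 2`: it lies outside the prism
and has at least two neighbours in each of the two triangles. -/
def IsMajorNeighborOfPrism {V : Type*} (G : SimpleGraph V) {a b : Fin 3 → V}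
    (R : ∀ i, G.Walk (a i) (b i)) (x : V) : Prop :=
  (∀ i, x ∉ (R i).support) ∧
  (∃ i j, i ≠ j ∧ G.Adj x (a i) ∧ G.Adj x (a j)) ∧
  (∃ i j, i ≠ j ∧ G.Adj x (b i) ∧ G.Adj x (b j))

/-- `p` is a rung of the strip `(A, C, B)`: a chordless path of `G` with one end in `A`, the other
end in `B`, and interior in `C`. -/
def IsRung {V : Type*} {G : SimpleGraph V} (A C B : Set V) {u v : V} (p : G.Walk u v) : Prop :=
  u ∈ A ∧ v ∈ B ∧ IsChordlessPath p ∧ ∀ w ∈ p.support, w = u ∨ w = v ∨ w ∈ C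

/-- The subgraph of `G` induced by `S` is a hyperprism, with partition
`A 0, C 0, B 0, …, A 2, C 2, B 2` of its vertex set `S`. -/
structure IsHyperprism {V : Type*} (G : SimpleGraph V) (S : Set V) (A C B : Fin 3 → Set V) :
    Prop where
  cover : S = ⋃ i, (A i ∪ B i ∪ C i)
  disjoint_AB : ∀ i, Disjoint (A i) (B i)
  disjoint_AC : ∀ i, Disjoint (A i) (C i)
  disjoint_BC : ∀ i, Disjoint (B i) (C i)
  disjoint_strips : ∀ i j, i ≠ j → Disjoint (A i ∪ B i ∪ C i) (A j ∪ B j ∪ C j)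
  nonempty_A : ∀ i, (A i).Nonempty
  nonempty_B : ∀ i, (B i).Nonempty
  complete_A : ∀ i j, i ≠ j → ∀ u ∈ A i, ∀ v ∈ A j, G.Adj u v
  complete_B : ∀ i j, i ≠ j → ∀ u ∈ B i, ∀ v ∈ B j, G.Adj u v
  only : ∀ i j, i ≠ j → ∀ u ∈ A i ∪ B i ∪ C i, ∀ v ∈ A j ∪ B j ∪ C j, G.Adj u v →
    (u ∈ A i ∧ v ∈ A j) ∨ (u ∈ B i ∧ v ∈ B j)
  on_rung : ∀ i, ∀ w ∈ A i ∪ B i ∪ C i, ∃ (u v : V) (p : G.Walk u v),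
    IsRung (A i) (C i) (B i) p ∧ w ∈ p.support

/-- The subgraph of `G` induced by `S` is a hyperprism, for some partition of `S`. -/
def InducesHyperprism {V : Type*} (G : SimpleGraph V) (S : Set V) : Prop :=
  ∃ A C B : Fin 3 → Set V, IsHyperprism G S A C B

/-- The subgraph of `G` induced by `S` is an even hyperprism with partition `A, C, B`:
all its rungs have even length. -/
def IsEvenHyperprism {V : Type*} (G : SimpleGraph V) (S : Set V) (A C B : Fin 3 → Set V) : Prop :=
  IsHyperprism G S A C B ∧
    ∀ i (u v : V) (p : G.Walk u v), IsRung (A i) (C i) (B i) p → Even p.length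

/-- `x` is a major neighbour of the hyperprism on `S` with partition `A, C, B`: it is a vertex
outside `S` that is a major neighbour of some instance, i.e. of the prism formed by some choice of
one rung in each of the three strips. -/
def IsMajorNeighborOfHyperprism {V : Type*} (G : SimpleGraph V) (S : Set V)
    (A C B : Fin 3 → Set V) (x : V) : Prop :=
  x ∉ S ∧ ∃ (a b : Fin 3 → V) (R : ∀ i, G.Walk (a i) (b i)),
    (∀ i, IsRung (A i) (C i) (B i) (R i)) ∧ IsMajorNeighborOfPrism G R x

/-- `x` is adjacent to every vertex of `T`. -/
def IsCompleteTo {V : Type*} (G : SimpleGraph V) (x : V) (T : Set V) : Prop :=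
  ∀ t ∈ T, G.Adj x t

end EvenHyperprism

/-! Parity drives everything: if `x` sees the two ends of an induced path of length other than 1 and
none of its other vertices, the path has even length, since otherwise `x` closes an odd hole
(`IndPath.even_of_apex`).

Suppose `x` is not complete to two of the `A i`; the `B` side is symmetric. Then two strips have
rungs whose `A`-end misses `x`. Exchanging these rungs one after the other in the given instance
must at some point leave `x` with fewer than two neighbours in one of the triangles. At that
exchange, parity forces a rigid picture (`touched_and_untouched`): two strips have a touched rung,
with both ends seen by `x`, and two strips have an untouched rung, with no neighbour of `x`. These
are spread so that, for every strip, one of the other two has a touched rung and the remaining one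
an untouched rung.

Hence every rung of every strip is touched or untouched (`dichotomy`). Within a strip, touched and
untouched rungs are disjoint, and the edges between them are exactly all those between their
`A`-ends and all those between their `B`-ends (`ends_of_adj`, `adj_fst_of_touched`). So the strips
can be regrouped: everything on touched rungs, together with `x`, becomes one strip, and the
untouched part splits into two others. This is the new hyperprism (`inducesHyperprism`). -/

namespace EvenHyperprism

/-! ### Induced paths: gluing, cutting, splicing. -/

/-- There is an induced path of length `n` from `u` to `v` in `G` with vertex set `s`. -/
inductive IndPath {V : Type*} (G : SimpleGraph V) : V → V → ℕ → Set V → Prop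
  | single (u : V) : IndPath G u u 0 {u}
  | cons {u v w : V} {n : ℕ} {s : Set V} (p : IndPath G v w n s) (h : G.Adj u v) (hu : u ∉ s)
      (ho : ∀ z ∈ s, G.Adj u z → z = v) : IndPath G u w (n + 1) (insert u s)

namespace IndPath

variable {V : Type*} {G : SimpleGraph V} {u v w x y z : V} {n m : ℕ} {s t : Set V}

theorem fst_mem (p : IndPath G u v n s) : u ∈ s := by
  cases p <;> simp

theorem snd_mem (p : IndPath G u v n s) : v ∈ s := by
  induction p with
  | single => simp
  | cons _ _ _ _ ih => exact Or.inr ih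

theorem join (p : IndPath G u v n s) {v' : V} (q : IndPath G v' w m t) (h : G.Adj v v')
    (hd : ∀ z ∈ s, z ∉ t) (ho : ∀ a ∈ s, ∀ b ∈ t, G.Adj a b → a = v ∧ b = v') :
    IndPath G u w (n + m + 1) (s ∪ t) := by
  induction p with
  | single u =>
    rw [Set.singleton_union, Nat.zero_add]
    exact cons q h (hd _ rfl) fun z hz hz' => (ho _ rfl _ hz hz').2
  | @cons a b c k r p h1 h2 h3 ih =>
    rw [Set.insert_union, show k + 1 + m + 1 = (k + m + 1) + 1 by omega]
    refine cons (ih h (fun z hz => hd z (Or.inr hz)) fun a ha => ho a (Or.inr ha)) h1 ?_ ?_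
    · rintro (h4 | h4)
      · exact h2 h4
      · exact hd _ (Or.inl rfl) h4
    · rintro z (hz | hz) h4
      · exact h3 z hz h4
      · have h5 := (ho _ (Or.inl rfl) _ hz h4).1
        exact absurd (h5 ▸ p.snd_mem) h2

theorem reverse (p : IndPath G u v n s) : IndPath G v u n s := by
  induction p with
  | single u => exact single u
  | @cons a b c k r p h1 h2 h3 ih =>
    have := ih.join (single a) h1.symm (by rintro z hz rfl; exact h2 hz)
      (by rintro z hz _ rfl h4; exact ⟨h3 z hz h4.symm, rfl⟩)
    rwa [Set.union_singleton] at this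

theorem eq_of_zero (p : IndPath G u v 0 s) : u = v := by
  cases p; rfl

theorem length_of_adj (p : IndPath G u v n s) (h : G.Adj u v) : n = 1 := by
  cases p with
  | single => exact absurd h (G.irrefl)
  | @cons _ b _ k r p h1 h2 h3 =>
    have h4 := h3 v p.snd_mem h
    subst h4
    cases p with
    | single => rfl
    | cons q _ h5 _ => exact absurd q.snd_mem h5

/-- The part of an induced path after the last vertex with property `Q`. -/
theorem last_hit (p : IndPath G u v n s) (Q : V → Prop) (h : ∃ z ∈ s, Q z) :
    ∃ y k t, IndPath G y v k t ∧ t ⊆ s ∧ Q y ∧ (∀ z ∈ t, Q z → z = y) ∧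
      (u ∈ t → y = u ∧ k = n) := by
  induction p with
  | single u =>
    obtain ⟨z, rfl, hz⟩ := h
    exact ⟨z, 0, {z}, single z, le_rfl, hz, fun _ h _ => h, fun _ => ⟨rfl, rfl⟩⟩
  | @cons a b c k r p h1 h2 h3 ih =>
    by_cases h4 : ∃ z ∈ r, Q z
    · obtain ⟨y, k', t, q, hts, hy, hu, _⟩ := ih h4
      exact ⟨y, k', t, q, fun z hz => Or.inr (hts hz), hy, hu, fun h => absurd (hts h) h2⟩
    · obtain ⟨z, hz | hz, hQ⟩ := h
      · subst hz
        exact ⟨z, k + 1, insert z r, cons p h1 h2 h3, le_rfl, hQ, by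
          rintro y (hy | hy) hQ'
          · exact hy
          · exact absurd ⟨y, hy, hQ'⟩ h4, fun _ => ⟨rfl, rfl⟩⟩
      · exact absurd ⟨z, hz, hQ⟩ h4

/-- The part of an induced path up to the first vertex with property `Q`. -/
theorem first_hit (p : IndPath G u v n s) (Q : V → Prop) (h : ∃ z ∈ s, Q z) :
    ∃ y k t, IndPath G u y k t ∧ t ⊆ s ∧ Q y ∧ (∀ z ∈ t, Q z → z = y) ∧
      (v ∈ t → y = v ∧ k = n) := by
  obtain ⟨y, k, t, q, h⟩ := p.reverse.last_hit Q h
  exact ⟨y, k, t, q.reverse, h⟩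

/-- Cutting the path at `u`, if `u` lies on it, or else at the last neighbour of `u`, removes every
chord. -/
theorem prepend (p : IndPath G v w n s) (h : u = v ∨ G.Adj u v) :
    ∃ k t, IndPath G u w k t ∧ t ⊆ insert u s := by
  by_cases hu : u ∈ s
  · obtain ⟨y, k, t, q, hts, rfl, _⟩ := p.last_hit (· = u) ⟨u, hu, rfl⟩
    exact ⟨k, t, q, hts.trans (Set.subset_insert _ _)⟩
  · have h : G.Adj u v := h.resolve_left fun h => hu (h ▸ p.fst_mem)
    obtain ⟨y, k, t, q, hts, hy, ho, _⟩ := p.last_hit (G.Adj u) ⟨v, p.fst_mem, h⟩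
    exact ⟨k + 1, insert u t, cons q hy (fun h => hu (hts h)) ho, Set.insert_subset_insert hts⟩

/-- Unlike `join`, this allows the two paths to meet or to have further edges between them, at the
price of losing control of the length. It serves where only the existence of an induced path
matters. -/
theorem splice (p : IndPath G u v n s) {v' : V} (q : IndPath G v' w m t)
    (h : v = v' ∨ G.Adj v v') : ∃ k r, IndPath G u w k r ∧ r ⊆ s ∪ t := by
  induction p with
  | single u => exact q.prepend h
  | @cons a b c k r p h1 h2 h3 ih =>
    obtain ⟨k, r', p', hr'⟩ := ih h
    obtain ⟨k, r'', p'', hr''⟩ := p'.prepend (Or.inr h1)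
    refine ⟨k, r'', p'', hr''.trans ?_⟩
    rw [Set.insert_union]
    exact Set.insert_subset_insert hr'

theorem enum (p : IndPath G u v n s) : ∃ f : ℕ → V, f 0 = u ∧ f n = v ∧ (∀ i ≤ n, f i ∈ s) ∧
    ∀ i ≤ n, ∀ j ≤ n, (f i = f j → i = j) ∧ (G.Adj (f i) (f j) ↔ i + 1 = j ∨ j + 1 = i) := by
  induction p with
  | single u => exact ⟨fun _ => u, rfl, rfl, fun _ _ => rfl, by simp⟩
  | @cons a b c k r p h1 h2 h3 ih =>
    obtain ⟨f, f0, fn, fs, hf⟩ := ih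
    have key : ∀ j ≤ k, a ≠ f j ∧ (G.Adj a (f j) ↔ j = 0) := by
      intro j hj
      refine ⟨fun h => h2 (h ▸ fs j hj), fun h => ?_, ?_⟩
      · exact (hf j hj 0 (Nat.zero_le _)).1 (f0.symm ▸ h3 _ (fs j hj) h)
      · rintro rfl
        exact f0.symm ▸ h1
    refine ⟨fun i => Nat.casesOn i a f, rfl, fn, ?_, ?_⟩
    · rintro (_ | i) hi
      · exact Or.inl rfl
      · exact Or.inr (fs i (by omega))
    · rintro (_ | i) hi (_ | j) hj
      · simp
      · have := key j (by omega)
        exact ⟨fun h => absurd h this.1, this.2.trans (by omega)⟩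
      · have := key i (by omega)
        exact ⟨fun h => absurd h.symm this.1, (G.adj_comm _ _).trans (this.2.trans (by omega))⟩
      · have := hf i (by omega) j (by omega)
        exact ⟨fun h => congrArg _ (this.1 h), this.2.trans (by omega)⟩

/-! ### Holes through an apex vertex, and translation to and from walks. -/

theorem cycleGraph_isIndContained (p : IndPath G u v n s) (hn : n ≠ 0) (hx : x ∉ s)
    (hu : G.Adj x u) (hv : G.Adj x v) (ho : ∀ z ∈ s, G.Adj x z → z = u ∨ z = v) :
    (cycleGraph (n + 2)).IsIndContained G := by
  obtain ⟨f, f0, fn, fs, hf⟩ := p.enum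
  have key : ∀ j ≤ n, x ≠ f j ∧ (G.Adj x (f j) ↔ j = 0 ∨ j = n) := by
    intro j hj
    refine ⟨fun h => hx (h ▸ fs j hj), fun h => ?_, ?_⟩
    · refine (ho _ (fs j hj) h).imp (fun h => ?_) fun h => ?_
      · exact (hf j hj 0 (Nat.zero_le _)).1 (f0.symm ▸ h)
      · exact (hf j hj n le_rfl).1 (fn.symm ▸ h)
    · rintro (rfl | rfl)
      · exact f0.symm ▸ hu
      · exact fn.symm ▸ hv
  -- The apex gets index 0 and the path is shifted to the indices 1, …, `n + 1`.
  let g : ℕ → V := fun i => Nat.casesOn i x f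
  have hg : ∀ i < n + 2, ∀ j < n + 2, (g i = g j → i = j) ∧
      (G.Adj (g i) (g j) ↔ i + 1 = j ∨ j + 1 = i ∨ i = 0 ∧ j = n + 1 ∨ j = 0 ∧ i = n + 1) := by
    rintro (_ | i) hi (_ | j) hj
    · simp [g]
    · have := key j (by omega)
      exact ⟨fun h => absurd h this.1, this.2.trans (by omega)⟩
    · have := key i (by omega)
      exact ⟨fun h => absurd h.symm this.1, (G.adj_comm _ _).trans (this.2.trans (by omega))⟩
    · have := hf i (by omega) j (by omega)
      exact ⟨fun h => congrArg _ (this.1 h), this.2.trans (by omega)⟩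
  refine ⟨⟨⟨fun i => g i, fun i j h => Fin.ext ((hg i i.2 j j.2).1 h)⟩, ?_⟩⟩
  intro i j
  refine (hg i i.2 j j.2).2.trans ?_
  obtain ⟨i, hi⟩ := i
  obtain ⟨j, hj⟩ := j
  rw [cycleGraph_adj', Fin.val_sub, Fin.val_sub]
  simp only
  -- Subtraction in `Fin` unfolds to a remainder; writing it piecewise linearly puts the goal within
  -- reach of `omega`.
  have hmod : ∀ a b : ℕ, a < n + 2 → b < n + 2 →
      (n + 2 - b + a) % (n + 2) = if b ≤ a then a - b else n + 2 - b + a := by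
    intro a b ha hb
    split_ifs with h
    · rw [show n + 2 - b + a = (a - b) + (n + 2) by omega, Nat.add_mod_right,
        Nat.mod_eq_of_lt (by omega)]
    · exact Nat.mod_eq_of_lt (by omega)
  rw [hmod i j hi hj, hmod j i hj hi]
  split_ifs <;> omega

/-- The path and `x` would form a hole of length `n + 2`. Only `n = 1` must be excluded, where they
form a triangle; for `n = 0` the conclusion is trivial. -/
theorem even_of_apex (hB : ¬ ContainsOddHole G) (p : IndPath G u v n s) (hn : n ≠ 1) (hx : x ∉ s)
    (hu : G.Adj x u) (hv : G.Adj x v) (ho : ∀ z ∈ s, G.Adj x z → z = u ∨ z = v) : Even n := by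
  by_contra h
  rw [Nat.not_even_iff_odd] at h
  have : 3 ≤ n := by obtain ⟨k, rfl⟩ := h; omega
  exact hB ⟨n + 2, by omega, h.add_even even_two,
    p.cycleGraph_isIndContained (by omega) hx hu hv ho⟩

theorem exists_walk (p : IndPath G u v n s) :
    ∃ q : G.Walk u v, IsChordlessPath q ∧ q.length = n ∧ ∀ z, z ∈ q.support ↔ z ∈ s := by
  induction p with
  | single u => exact ⟨Walk.nil, ⟨by simp, by simp [Walk.isChordless_iff_forall_mem_edges]⟩, rfl,
      by simp⟩
  | @cons a b c k r p h1 h2 h3 ih =>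
    obtain ⟨q, ⟨hq1, hq2⟩, hq3, hq4⟩ := ih
    refine ⟨Walk.cons h1 q, ⟨?_, ?_⟩, by simp [hq3], by simp [hq4]⟩
    · rw [Walk.cons_isPath_iff, hq4]
      exact ⟨hq1, h2⟩
    · rw [Walk.isChordless_iff_forall_mem_edges] at hq2 ⊢
      simp only [Walk.support_cons, List.mem_cons, Walk.edges_cons]
      rintro c d (rfl | hc) (rfl | hd) h
      · exact absurd h G.irrefl
      · exact Or.inl (by rw [h3 d ((hq4 d).1 hd) h])
      · exact Or.inl (by rw [h3 c ((hq4 c).1 hc) h.symm, Sym2.eq_swap])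
      · exact Or.inr (hq2 hc hd h)

theorem of_walk (q : G.Walk u v) (hq : IsChordlessPath q) :
    IndPath G u v q.length {z | z ∈ q.support} := by
  induction q with
  | nil => simpa using single (G := G) _
  | @cons a b c h q ih =>
    obtain ⟨h1, h2⟩ := hq
    rw [Walk.cons_isPath_iff] at h1
    rw [Walk.isChordless_iff_forall_mem_edges] at h2
    have h3 : q.IsChordless := by
      rw [Walk.isChordless_iff_forall_mem_edges]
      intro d e hd he hde
      have := h2 (by simp [hd]) (by simp [he]) hde
      rw [Walk.edges_cons, List.mem_cons] at this
      rcases this with h4 | h4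
      · rw [Sym2.eq_iff] at h4
        rcases h4 with ⟨rfl, -⟩ | ⟨-, rfl⟩
        · exact absurd hd h1.2
        · exact absurd he h1.2
      · exact h4
    have h4 := cons (ih ⟨h1.1, h3⟩) h h1.2 (by
      intro z hz haz
      have := h2 (by simp) (by simp [show z ∈ q.support from hz]) haz
      rw [Walk.edges_cons, List.mem_cons] at this
      rcases this with h4 | h4
      · rw [Sym2.eq_iff] at h4
        rcases h4 with ⟨-, rfl⟩ | ⟨h5, rfl⟩
        · rfl
        · exact absurd haz G.irrefl
      · exact absurd (q.fst_mem_support_of_mem_edges h4) h1.2)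
    have h5 : {z | z ∈ (Walk.cons h q).support} = insert a {z | z ∈ q.support} := by
      ext; simp
    rw [h5]
    exact h4

end IndPath

/-! ### Parity constraints on the neighbours of `x` in an even prism. -/

variable {V : Type*} {G : SimpleGraph V} {x : V}

/-- An induced path of even length with distinct ends, avoiding the vertex `x`. -/
structure EvenPath (G : SimpleGraph V) (x a b : V) (s : Set V) : Prop where
  path : ∃ n, IndPath G a b n s ∧ Even n
  ne : a ≠ b
  notMem : x ∉ s

/-- Two vertex-disjoint sets `s ∋ a, b` and `s' ∋ a', b'` whose connecting edges are exactly
`aa'` and `bb'`. -/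
structure Linked (G : SimpleGraph V) (a b : V) (s : Set V) (a' b' : V) (s' : Set V) : Prop where
  disj : ∀ z ∈ s, z ∉ s'
  adj_fst : G.Adj a a'
  adj_snd : G.Adj b b'
  only : ∀ u ∈ s, ∀ v ∈ s', G.Adj u v → u = a ∧ v = a' ∨ u = b ∧ v = b'

theorem EvenPath.reverse {a b : V} {s : Set V} (h : EvenPath G x a b s) : EvenPath G x b a s := by
  obtain ⟨⟨n, p, hn⟩, h1, h2⟩ := h
  exact ⟨⟨n, p.reverse, hn⟩, h1.symm, h2⟩

theorem EvenPath.not_adj {a b : V} {s : Set V} (h : EvenPath G x a b s) : ¬ G.Adj a b := by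
  obtain ⟨⟨n, p, hn⟩, -, -⟩ := h
  intro h
  rw [p.length_of_adj h] at hn
  exact absurd hn (by decide)

theorem EvenPath.fst_mem {a b : V} {s : Set V} (h : EvenPath G x a b s) : a ∈ s :=
  let ⟨_, p, _⟩ := h.path; p.fst_mem

theorem EvenPath.snd_mem {a b : V} {s : Set V} (h : EvenPath G x a b s) : b ∈ s :=
  let ⟨_, p, _⟩ := h.path; p.snd_mem

variable {a b a₁ b₁ a₂ b₂ a₃ b₃ : V} {s s₁ s₂ s₃ : Set V}

theorem Linked.symm (h : Linked G a₁ b₁ s₁ a₂ b₂ s₂) : Linked G a₂ b₂ s₂ a₁ b₁ s₁ :=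
  ⟨fun z hz hz' => h.disj z hz' hz, h.adj_fst.symm, h.adj_snd.symm,
    fun u hu v hv huv => (h.only v hv u hu huv.symm).imp And.symm And.symm⟩

theorem Linked.reverse (h : Linked G a₁ b₁ s₁ a₂ b₂ s₂) : Linked G b₁ a₁ s₁ b₂ a₂ s₂ :=
  ⟨h.disj, h.adj_snd, h.adj_fst, fun u hu v hv huv => (h.only u hu v hv huv).symm⟩

/-- Preceding the segment `a₃`–`y` by `a₁` gives an induced path of length `k + 1` in which `x` sees
only the ends, so `k` is odd. -/
theorem EvenPath.exists_first_neighbor (hB : ¬ ContainsOddHole G)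
    (h₁ : EvenPath G x a₁ b₁ s₁) (h₃ : EvenPath G x a₃ b₃ s₃)
    (h₁₃ : Linked G a₁ b₁ s₁ a₃ b₃ s₃) (ha₁ : G.Adj x a₁) (ha₃ : ¬ G.Adj x a₃)
    (hN : ∃ z ∈ s₃, G.Adj x z) :
    ∃ y k t, IndPath G a₃ y k t ∧ t ⊆ s₃ ∧ G.Adj x y ∧ (∀ z ∈ t, G.Adj x z → z = y) ∧ Odd k ∧
      b₃ ∉ t := by
  obtain ⟨n, p, hn⟩ := h₃.path
  obtain ⟨y, k, t, q, hts, hy, hu, hb⟩ := p.first_hit (G.Adj x) hN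
  have hk0 : k ≠ 0 := by
    rintro rfl
    exact ha₃ (q.eq_of_zero ▸ hy)
  have hk : Odd k := by
    have hj := (IndPath.single (G := G) a₁).join q h₁₃.adj_fst
      (by rintro z rfl hz; exact h₁₃.disj _ h₁.fst_mem (hts hz)) (by
        rintro _ rfl z hz h
        rcases h₁₃.only _ h₁.fst_mem z (hts hz) h with h | h
        · exact h
        · exact absurd h.1 h₁.ne)
    have he := hj.even_of_apex hB (x := x) (by omega) (by
      rintro (hz | hz)
      · exact h₁.notMem (hz ▸ h₁.fst_mem)
      · exact h₃.notMem (hts hz)) ha₁ hy (by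
      rintro z (rfl | hz) h
      · exact Or.inl rfl
      · exact Or.inr (hu z hz h))
    by_contra h
    rw [Nat.not_odd_iff_even] at h
    rw [Nat.zero_add, Nat.even_add_one] at he
    exact he h
  -- If the segment reached `b₃`, it would be the whole path, whose length is even.
  refine ⟨y, k, t, q, hts, hy, hu, hk, fun h => ?_⟩
  rw [(hb h).2] at hk
  exact (Nat.not_even_iff_odd.2 hk) hn

/-- If `x` is adjacent to `a₁`, not to `a₂` and `a₃`, and it has a neighbour in the third path of
an even prism, then it has none in the second. -/
theorem EvenPath.anticomplete_of_neighbor (hB : ¬ ContainsOddHole G)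
    (h₁ : EvenPath G x a₁ b₁ s₁) (h₂ : EvenPath G x a₂ b₂ s₂) (h₃ : EvenPath G x a₃ b₃ s₃)
    (h₁₂ : Linked G a₁ b₁ s₁ a₂ b₂ s₂) (h₁₃ : Linked G a₁ b₁ s₁ a₃ b₃ s₃)
    (h₂₃ : Linked G a₂ b₂ s₂ a₃ b₃ s₃)
    (ha₁ : G.Adj x a₁) (ha₂ : ¬ G.Adj x a₂) (ha₃ : ¬ G.Adj x a₃)
    (hN : ∃ z ∈ s₃, G.Adj x z) : ∀ z ∈ s₂, ¬ G.Adj x z := by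
  intro w hw hxw
  obtain ⟨y, k, t, p, hts, hy, hu, hk, hb⟩ := h₁.exists_first_neighbor hB h₃ h₁₃ ha₁ ha₃ hN
  obtain ⟨y', k', t', p', hts', hy', hu', hk', hb'⟩ :=
    h₁.exists_first_neighbor hB h₂ h₁₂ ha₁ ha₂ ⟨w, hw, hxw⟩
  -- The path `y`–…–`a₃`–`a₂`–…–`y'` has length `k + k' + 1`, which is odd.
  have hj := p.reverse.join p' h₂₃.adj_fst.symm
    (fun z hz hz' => h₂₃.disj z (hts' hz') (hts hz)) (by
      intro c hc d hd h
      rcases h₂₃.only d (hts' hd) c (hts hc) h.symm with h | h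
      · exact h.symm
      · exact absurd (h.2 ▸ hc) hb)
  have he := hj.even_of_apex hB (x := x) (by have := hk.pos; omega) (by
      rintro (hz | hz)
      · exact h₃.notMem (hts hz)
      · exact h₂.notMem (hts' hz)) hy hy' (by
      rintro z (hz | hz) h
      · exact Or.inl (hu z hz h)
      · exact Or.inr (hu' z hz h))
  exact (Nat.even_add_one.1 he) (hk.add_odd hk')

/-- If `x` is adjacent to both ends of the first path of an even prism and not to `a₂`, `a₃`, then
it has no neighbour in the third path. -/
theorem EvenPath.anticomplete_of_ends (hB : ¬ ContainsOddHole G)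
    (h₁ : EvenPath G x a₁ b₁ s₁) (h₂ : EvenPath G x a₂ b₂ s₂) (h₃ : EvenPath G x a₃ b₃ s₃)
    (h₁₂ : Linked G a₁ b₁ s₁ a₂ b₂ s₂) (h₁₃ : Linked G a₁ b₁ s₁ a₃ b₃ s₃)
    (h₂₃ : Linked G a₂ b₂ s₂ a₃ b₃ s₃)
    (ha₁ : G.Adj x a₁) (hb₁ : G.Adj x b₁) (ha₂ : ¬ G.Adj x a₂) (ha₃ : ¬ G.Adj x a₃) :
    ∀ z ∈ s₃, ¬ G.Adj x z := by
  intro w hw hxw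
  have hT := h₁.anticomplete_of_neighbor hB h₂ h₃ h₁₂ h₁₃ h₂₃ ha₁ ha₂ ha₃ ⟨w, hw, hxw⟩
  obtain ⟨y, k, t, p, hts, hy, hu, hk, hb⟩ :=
    h₁.exists_first_neighbor hB h₃ h₁₃ ha₁ ha₃ ⟨w, hw, hxw⟩
  obtain ⟨n, q, hn⟩ := h₂.path
  -- The path `y`–…–`a₃`–`a₂`–…–`b₂`–`b₁` has odd length `k + n + 2`, and `x` sees only its ends.
  have hj := p.reverse.join q h₂₃.adj_fst.symm
    (fun z hz hz' => h₂₃.disj z hz' (hts hz)) (by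
      intro c hc d hd h
      rcases h₂₃.only d hd c (hts hc) h.symm with h | h
      · exact h.symm
      · exact absurd (h.2 ▸ hc) hb)
  have hj' := hj.join (IndPath.single b₁) h₁₂.adj_snd.symm (by
      rintro z (hz | hz) rfl
      · exact h₁₃.disj _ h₁.snd_mem (hts hz)
      · exact h₁₂.disj _ h₁.snd_mem hz) (by
      rintro c (hc | hc) _ rfl h
      · rcases h₁₃.only _ h₁.snd_mem c (hts hc) h.symm with h | h
        · exact absurd h.1.symm h₁.ne
        · exact absurd (h.2 ▸ hc) hb
      · rcases h₁₂.only _ h₁.snd_mem c hc h.symm with h | h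
        · exact absurd h.1.symm h₁.ne
        · exact h.symm)
  have he := hj'.even_of_apex hB (x := x) (by omega) (by
      rintro ((hz | hz) | hz)
      · exact h₃.notMem (hts hz)
      · exact h₂.notMem hz
      · exact h₁.notMem (hz ▸ h₁.snd_mem)) hy hb₁ (by
      rintro z ((hz | hz) | hz) h
      · exact Or.inl (hu z hz h)
      · exact absurd h (hT z hz)
      · exact Or.inr hz)
  rw [Nat.add_zero] at he
  have := hk.add_even hn
  rw [Nat.even_add_one, Nat.even_add_one, not_not] at he
  exact Nat.not_even_iff_odd.2 this he

/-- In an even prism, let `x` be adjacent to `a₁` and `b₃` but not to `a₂`, `a₃`, `b₁`. Then `x`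
has no neighbour `b` adjacent to `b₁`, not to `a₁`, and to no vertex of the third path other
than `b₃`. -/
theorem EvenPath.false_of_crossing (hB : ¬ ContainsOddHole G)
    (h₁ : EvenPath G x a₁ b₁ s₁) (h₂ : EvenPath G x a₂ b₂ s₂) (h₃ : EvenPath G x a₃ b₃ s₃)
    (h₁₂ : Linked G a₁ b₁ s₁ a₂ b₂ s₂) (h₁₃ : Linked G a₁ b₁ s₁ a₃ b₃ s₃)
    (h₂₃ : Linked G a₂ b₂ s₂ a₃ b₃ s₃)
    (ha₁ : G.Adj x a₁) (ha₂ : ¬ G.Adj x a₂) (ha₃ : ¬ G.Adj x a₃) (hb₁ : ¬ G.Adj x b₁)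
    (hb₃ : G.Adj x b₃) (hb : G.Adj x b) (hbb : G.Adj b b₁) (hba : ¬ G.Adj b a₁)
    (hb3 : b ∉ s₃) (ho : ∀ z ∈ s₃, G.Adj b z → z = b₃) (hne : b ≠ a₁) : False := by
  have hT := h₁.anticomplete_of_neighbor hB h₂ h₃ h₁₂ h₁₃ h₂₃ ha₁ ha₂ ha₃ ⟨b₃, h₃.snd_mem, hb₃⟩
  obtain ⟨y, k, t, p, hts, hy, hu, hk, hbt⟩ :=
    h₁.exists_first_neighbor hB h₃ h₁₃ ha₁ ha₃ ⟨b₃, h₃.snd_mem, hb₃⟩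
  obtain ⟨n, q, hn⟩ := h₂.path
  have hxb : x ≠ b := hb.ne
  have hb2 : b ∉ s₂ := fun h => hT b h hb
  by_cases hW : ∃ w ∈ s₂, G.Adj b w
  -- From `b` through `w` back to `a₂`, one can continue to `a₁` or along the third path to `y`. The
  -- lengths `m + 2` and `m + k + 2` would both have to be even, although `k` is odd.
  · obtain ⟨w, m, r, q', hrs, hw, hwu, -⟩ := q.first_hit (G.Adj b) hW
    have hj := (IndPath.single b).join q'.reverse hw
      (by rintro z rfl hz; exact hb2 (hrs hz)) (by
        rintro _ rfl z hz h
        exact ⟨rfl, hwu z hz h⟩)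
    have hj1 := hj.join (IndPath.single a₁) h₁₂.adj_fst.symm (by
        rintro z (hz | hz) rfl
        · exact hne hz.symm
        · exact h₁₂.disj _ h₁.fst_mem (hrs hz)) (by
        rintro c (rfl | hc) _ rfl h
        · exact absurd h hba
        · rcases h₁₂.only _ h₁.fst_mem c (hrs hc) h.symm with h | h
          · exact h.symm
          · exact absurd h.1 h₁.ne)
    have hj2 := hj.join p h₂₃.adj_fst (by
        rintro z (rfl | hz) hz'
        · exact hb3 (hts hz')
        · exact h₂₃.disj _ (hrs hz) (hts hz')) (by
        rintro c (rfl | hc) d hd h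
        · exact absurd (ho d (hts hd) h ▸ hd) hbt
        · rcases h₂₃.only _ (hrs hc) d (hts hd) h with h | h
          · exact h
          · exact absurd (h.2 ▸ hd) hbt)
    have he1 := hj1.even_of_apex hB (x := x) (by omega) (by
      rintro ((hz | hz) | hz)
      · exact hxb hz
      · exact h₂.notMem (hrs hz)
      · exact ha₁.ne hz) hb ha₁ (by
      rintro z ((hz | hz) | hz) h
      · exact Or.inl hz
      · exact absurd h (hT z (hrs hz))
      · exact Or.inr hz)
    have he2 := hj2.even_of_apex hB (x := x) (by omega) (by
      rintro ((hz | hz) | hz)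
      · exact hxb hz
      · exact h₂.notMem (hrs hz)
      · exact h₃.notMem (hts hz)) hb hy (by
      rintro z ((hz | hz) | hz) h
      · exact Or.inl hz
      · exact absurd h (hT z (hrs hz))
      · exact Or.inr (hu z hz h))
    have : Even m := by
      rwa [Nat.zero_add, Nat.add_zero, Nat.even_add_one, Nat.even_add_one, not_not] at he1
    have := this.add_odd hk
    rw [show 0 + m + 1 + k + 1 = (m + k + 1) + 1 by omega, Nat.even_add_one, Nat.even_add_one,
      not_not] at he2
    exact Nat.not_even_iff_odd.2 this he2
  · push Not at hW
    -- Now `b`–`b₁`–`b₂`–…–`a₂`–`a₁` is induced, of odd length `n + 3`.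
    have hj := q.reverse.join (IndPath.single a₁) h₁₂.adj_fst.symm (by
        rintro z hz rfl
        exact h₁₂.disj _ h₁.fst_mem hz) (by
        rintro c hc _ rfl h
        rcases h₁₂.only _ h₁.fst_mem c hc h.symm with h | h
        · exact h.symm
        · exact absurd h.1 h₁.ne)
    have hj1 := (IndPath.single b₁).join hj h₁₂.adj_snd (by
        rintro z rfl (hz | hz)
        · exact h₁₂.disj _ h₁.snd_mem hz
        · exact h₁.ne hz.symm) (by
        rintro _ rfl c (hc | rfl) h
        · rcases h₁₂.only _ h₁.snd_mem c hc h with h | h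
          · exact absurd h.1.symm h₁.ne
          · exact h
        · exact absurd h.symm h₁.not_adj)
    have hj2 := (IndPath.single b).join hj1 hbb (by
        rintro z rfl (hz | hz | hz)
        · exact hbb.ne hz
        · exact hb2 hz
        · exact hne hz) (by
        rintro _ rfl c (hc | hc | rfl) h
        · exact ⟨rfl, hc⟩
        · exact absurd h (hW c hc)
        · exact absurd h hba)
    have he := hj2.even_of_apex hB (x := x) (by omega) (by
      rintro (hz | hz | hz | hz)
      · exact hxb hz
      · exact h₁.notMem (hz ▸ h₁.snd_mem)
      · exact h₂.notMem hz
      · exact ha₁.ne hz) hb ha₁ (by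
      rintro z (hz | rfl | hz | hz) h
      · exact Or.inl hz
      · exact absurd h hb₁
      · exact absurd h (hT z hz)
      · exact Or.inr hz)
    rw [show 0 + (0 + (n + 0 + 1) + 1) + 1 = n + 1 + 1 + 1 by omega, Nat.even_add_one,
      Nat.even_add_one, Nat.even_add_one, not_not] at he
    exact he hn

/-- In an even prism, let `x` be adjacent to `b₁` and anticomplete to the second and third paths.
A neighbour `a` of `x` that is adjacent to `a₃`, not to `b₁`, and to no vertex of the second path
other than `a₂`, is adjacent to `a₂`. -/
theorem EvenPath.adj_of_anticomplete (hB : ¬ ContainsOddHole G)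
    (h₁ : EvenPath G x a₁ b₁ s₁) (h₂ : EvenPath G x a₂ b₂ s₂) (h₃ : EvenPath G x a₃ b₃ s₃)
    (h₁₂ : Linked G a₁ b₁ s₁ a₂ b₂ s₂) (h₁₃ : Linked G a₁ b₁ s₁ a₃ b₃ s₃)
    (h₂₃ : Linked G a₂ b₂ s₂ a₃ b₃ s₃)
    (hb₁ : G.Adj x b₁) (hx₂ : ∀ z ∈ s₂, ¬ G.Adj x z) (hx₃ : ∀ z ∈ s₃, ¬ G.Adj x z)
    (ha : G.Adj x a) (haa : G.Adj a a₃) (hab : ¬ G.Adj a b₁) (hne : a ≠ b₁)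
    (ho : ∀ z ∈ s₂, G.Adj a z → z = a₂) : G.Adj a a₂ := by
  by_contra hcon
  obtain ⟨n, q, hn⟩ := h₂.path
  have ha2 : a ∉ s₂ := fun h => hx₂ a h ha
  -- Without the edge `aa₂`, the path `a`–`a₃`–`a₂`–…–`b₂`–`b₁` is induced, of odd length `n + 3`,
  -- and `x` sees only its ends.
  have hj := q.join (IndPath.single b₁) h₁₂.adj_snd.symm (by
      rintro z hz rfl
      exact h₁₂.disj _ h₁.snd_mem hz) (by
      rintro c hc _ rfl h
      rcases h₁₂.only _ h₁.snd_mem c hc h.symm with h | h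
      · exact absurd h.1.symm h₁.ne
      · exact h.symm)
  have hj1 := (IndPath.single a₃).join hj h₂₃.adj_fst.symm (by
      rintro z rfl (hz | hz)
      · exact h₂₃.disj _ hz h₃.fst_mem
      · exact h₁₃.disj _ h₁.snd_mem (hz ▸ h₃.fst_mem)) (by
      rintro _ rfl c (hc | rfl) h
      · rcases h₂₃.only _ hc _ h₃.fst_mem h.symm with h | h
        · exact h.symm
        · exact absurd h.2 h₃.ne
      · rcases h₁₃.only _ h₁.snd_mem _ h₃.fst_mem h.symm with h | h
        · exact absurd h.1.symm h₁.ne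
        · exact absurd h.2 h₃.ne)
  have hj2 := (IndPath.single a).join hj1 haa (by
      rintro z rfl (hz | hz | hz)
      · exact haa.ne hz
      · exact ha2 hz
      · exact hne hz) (by
      rintro _ rfl c (hc | hc | rfl) h
      · exact ⟨rfl, hc⟩
      · exact absurd (ho c hc h ▸ h) hcon
      · exact absurd h hab)
  have he := hj2.even_of_apex hB (x := x) (by omega) (by
    rintro (hz | hz | hz | hz)
    · exact ha.ne hz
    · exact h₃.notMem (hz ▸ h₃.fst_mem)
    · exact h₂.notMem hz
    · exact hb₁.ne hz) ha hb₁ (by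
    rintro z (hz | rfl | hz | hz) h
    · exact Or.inl hz
    · exact absurd h (hx₃ _ h₃.fst_mem)
    · exact absurd h (hx₂ z hz)
    · exact Or.inr hz)
  rw [show 0 + (0 + (n + 0 + 1) + 1) + 1 = n + 1 + 1 + 1 by omega, Nat.even_add_one,
    Nat.even_add_one, Nat.even_add_one, not_not] at he
  exact he hn

/-! ### Rungs as vertex sets, and the structure of hyperprisms. -/

variable {S : Set V} {A C B : Fin 3 → Set V}

/-- `s` is the vertex set of an `i`-rung with ends `a`, `b`. -/
structure RungSet (G : SimpleGraph V) (A C B : Fin 3 → Set V) (i : Fin 3) (a b : V) (s : Set V) :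
    Prop where
  fst : a ∈ A i
  snd : b ∈ B i
  path : ∃ n, IndPath G a b n s
  interior : ∀ z ∈ s, z = a ∨ z = b ∨ z ∈ C i

theorem RungSet.reverse {i : Fin 3} {a b : V} {s : Set V} (h : RungSet G A C B i a b s) :
    RungSet G B C A i b a s :=
  ⟨h.snd, h.fst, let ⟨n, p⟩ := h.path; ⟨n, p.reverse⟩, fun z hz => by
    have := h.interior z hz; tauto⟩

theorem RungSet.fst_mem {i : Fin 3} {a b : V} {s : Set V} (h : RungSet G A C B i a b s) : a ∈ s :=
  let ⟨_, p⟩ := h.path; p.fst_mem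

theorem RungSet.snd_mem {i : Fin 3} {a b : V} {s : Set V} (h : RungSet G A C B i a b s) : b ∈ s :=
  let ⟨_, p⟩ := h.path; p.snd_mem

theorem RungSet.subset {i : Fin 3} {a b : V} {s : Set V} (h : RungSet G A C B i a b s) :
    ∀ z ∈ s, z ∈ A i ∪ B i ∪ C i := by
  intro z hz
  rcases h.interior z hz with rfl | rfl | hz
  · exact Or.inl (Or.inl h.fst)
  · exact Or.inl (Or.inr h.snd)
  · exact Or.inr hz

/-- Two rungs of a strip that meet or are joined by an edge can be recombined. -/
theorem RungSet.recombine {i : Fin 3} {a b a' b' u v : V} {s s' : Set V}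
    (h : RungSet G A C B i a b s) (h' : RungSet G A C B i a' b' s') (hu : u ∈ s) (hv : v ∈ s')
    (huv : u = v ∨ G.Adj u v) (hub : u ≠ b) (hva : v ≠ a') : ∃ r, RungSet G A C B i a b' r := by
  obtain ⟨n, p⟩ := h.path
  obtain ⟨n', p'⟩ := h'.path
  -- Since `u ≠ b` and `v ≠ a'`, the two cuts discard `b` and `a'`, so that no vertex other than the
  -- new ends lies outside `C i`.
  obtain ⟨_, k, t, q, hts, rfl, -, hb⟩ := p.first_hit (· = u) ⟨u, hu, rfl⟩
  obtain ⟨_, k', t', q', hts', rfl, -, ha'⟩ := p'.last_hit (· = v) ⟨v, hv, rfl⟩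
  obtain ⟨m, r, w, hr⟩ := q.splice q' huv
  refine ⟨r, h.fst, h'.snd, ⟨m, w⟩, fun z hz => ?_⟩
  rcases hr hz with hz | hz
  · rcases h.interior z (hts hz) with h1 | rfl | h1
    · exact Or.inl h1
    · exact absurd (hb hz).1 hub
    · exact Or.inr (Or.inr h1)
  · rcases h'.interior z (hts' hz) with rfl | h1
    · exact absurd (ha' hz).1 hva
    · exact Or.inr h1

namespace IsHyperprism

theorem symm (h : IsHyperprism G S A C B) : IsHyperprism G S B C A where
  cover := by
    rw [h.cover]
    exact Set.iUnion_congr fun i => by rw [Set.union_comm (A i)]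
  disjoint_AB i := (h.disjoint_AB i).symm
  disjoint_AC := h.disjoint_BC
  disjoint_BC := h.disjoint_AC
  disjoint_strips i j hij := by
    rw [Set.union_comm (B i), Set.union_comm (B j)]
    exact h.disjoint_strips i j hij
  nonempty_A := h.nonempty_B
  nonempty_B := h.nonempty_A
  complete_A := h.complete_B
  complete_B := h.complete_A
  only i j hij u hu v hv huv := by
    rw [Set.union_comm (B i)] at hu
    rw [Set.union_comm (B j)] at hv
    exact (h.only i j hij u hu v hv huv).symm
  on_rung i w hw := by
    rw [Set.union_comm (B i)] at hw
    obtain ⟨u, v, p, ⟨hu, hv, ⟨hp, hc⟩, hi⟩, hwp⟩ := h.on_rung i w hw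
    refine ⟨v, u, p.reverse, ⟨hv, hu, ⟨hp.reverse, ?_⟩, ?_⟩, by simpa using hwp⟩
    · rw [Walk.isChordless_iff_forall_mem_edges] at hc ⊢
      simpa using hc
    · intro z hz
      rw [Walk.support_reverse, List.mem_reverse] at hz
      have := hi z hz
      tauto

theorem strip_eq (h : IsHyperprism G S A C B) {i j : Fin 3} {z : V} (hi : z ∈ A i ∪ B i ∪ C i)
    (hj : z ∈ A j ∪ B j ∪ C j) : i = j := by
  by_contra hij
  exact Set.disjoint_left.1 (h.disjoint_strips i j hij) hi hj

theorem disjoint_AB' (h : IsHyperprism G S A C B) {i j : Fin 3} {z : V} (hi : z ∈ A i) :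
    z ∉ B j := by
  intro hj
  obtain rfl := h.strip_eq (Or.inl (Or.inl hi)) (Or.inl (Or.inr hj))
  exact Set.disjoint_left.1 (h.disjoint_AB i) hi hj

theorem disjoint_AC' (h : IsHyperprism G S A C B) {i j : Fin 3} {z : V} (hi : z ∈ A i) :
    z ∉ C j := by
  intro hj
  obtain rfl := h.strip_eq (Or.inl (Or.inl hi)) (Or.inr hj)
  exact Set.disjoint_left.1 (h.disjoint_AC i) hi hj

theorem not_adj_AB (h : IsHyperprism G S A C B) {i j : Fin 3} (hij : i ≠ j) {a b : V}
    (ha : a ∈ A i) (hb : b ∈ B j) : ¬ G.Adj a b := by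
  intro hab
  rcases h.only i j hij a (Or.inl (Or.inl ha)) b (Or.inl (Or.inr hb)) hab with h1 | h1
  · exact h.disjoint_AB' h1.2 hb
  · exact h.disjoint_AB' ha h1.1

theorem eq_fst (h : IsHyperprism G S A C B) {i j : Fin 3} {a b z : V} {s : Set V}
    (r : RungSet G A C B i a b s) (hz : z ∈ s) (hzA : z ∈ A j) : z = a := by
  rcases r.interior z hz with h1 | rfl | h1
  · exact h1
  · exact absurd r.snd (h.disjoint_AB' hzA)
  · exact absurd h1 (h.disjoint_AC' hzA)

theorem eq_snd (h : IsHyperprism G S A C B) {i j : Fin 3} {a b z : V} {s : Set V}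
    (r : RungSet G A C B i a b s) (hz : z ∈ s) (hzB : z ∈ B j) : z = b :=
  h.symm.eq_fst r.reverse hz hzB

theorem mem_of_strip (h : IsHyperprism G S A C B) {i : Fin 3} {z : V}
    (hz : z ∈ A i ∪ B i ∪ C i) : z ∈ S := by
  rw [h.cover]
  exact Set.mem_iUnion.2 ⟨i, hz⟩

theorem linked (h : IsHyperprism G S A C B) {i j : Fin 3} (hij : i ≠ j) {a b a' b' : V}
    {s s' : Set V} (r : RungSet G A C B i a b s) (r' : RungSet G A C B j a' b' s') :
    Linked G a b s a' b' s' where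
  disj z hz hz' := hij (h.strip_eq (r.subset z hz) (r'.subset z hz'))
  adj_fst := h.complete_A i j hij a r.fst a' r'.fst
  adj_snd := h.complete_B i j hij b r.snd b' r'.snd
  only u hu v hv huv := by
    rcases h.only i j hij u (r.subset u hu) v (r'.subset v hv) huv with h1 | h1
    · exact Or.inl ⟨h.eq_fst r hu h1.1, h.eq_fst r' hv h1.2⟩
    · exact Or.inr ⟨h.eq_snd r hu h1.1, h.eq_snd r' hv h1.2⟩

theorem exists_rungSet (h : IsHyperprism G S A C B) {i : Fin 3} {z : V}
    (hz : z ∈ A i ∪ B i ∪ C i) : ∃ a b s, RungSet G A C B i a b s ∧ z ∈ s := by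
  obtain ⟨u, v, p, ⟨hu, hv, hp, hi⟩, hzp⟩ := h.on_rung i z hz
  exact ⟨u, v, _, ⟨hu, hv, ⟨_, IndPath.of_walk p hp⟩, hi⟩, hzp⟩

/-- A vertex labelling `c` that separates the strips gives a hyperprism. -/
theorem of_label {𝒜 ℬ 𝒞 : Set V} (c : V → Fin 3) (hS : S = 𝒜 ∪ ℬ ∪ 𝒞)
    (hAB : Disjoint 𝒜 ℬ) (hAC : Disjoint 𝒜 𝒞) (hBC : Disjoint ℬ 𝒞)
    (hneA : ∀ i, ∃ z ∈ 𝒜, c z = i) (hneB : ∀ i, ∃ z ∈ ℬ, c z = i)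
    (hA : ∀ u ∈ 𝒜, ∀ v ∈ 𝒜, c u ≠ c v → G.Adj u v)
    (hB : ∀ u ∈ ℬ, ∀ v ∈ ℬ, c u ≠ c v → G.Adj u v)
    (ho : ∀ u ∈ S, ∀ v ∈ S, c u ≠ c v → G.Adj u v → u ∈ 𝒜 ∧ v ∈ 𝒜 ∨ u ∈ ℬ ∧ v ∈ ℬ)
    (hr : ∀ w ∈ S, ∃ u ∈ 𝒜, ∃ v ∈ ℬ, ∃ n s, IndPath G u v n s ∧ w ∈ s ∧
      (∀ z ∈ s, z = u ∨ z = v ∨ z ∈ 𝒞) ∧ ∀ z ∈ s, c z = c w) :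
    IsHyperprism G S (fun i => {z ∈ 𝒜 | c z = i}) (fun i => {z ∈ 𝒞 | c z = i})
      (fun i => {z ∈ ℬ | c z = i}) := by
  have key : ∀ i z, z ∈ {z ∈ 𝒜 | c z = i} ∪ {z ∈ ℬ | c z = i} ∪ {z ∈ 𝒞 | c z = i} ↔
      z ∈ S ∧ c z = i := by
    intro i z
    rw [hS]
    simp only [Set.mem_union, Set.mem_ofPred_eq]
    tauto
  refine ⟨?_, fun i => ?_, fun i => ?_, fun i => ?_, fun i j hij => ?_, hneA, hneB, ?_, ?_, ?_, ?_⟩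
  · ext z
    simp only [Set.mem_iUnion, key, exists_and_left, exists_eq', and_true]
  · exact hAB.mono (fun _ h => h.1) fun _ h => h.1
  · exact hAC.mono (fun _ h => h.1) fun _ h => h.1
  · exact hBC.mono (fun _ h => h.1) fun _ h => h.1
  · rw [Set.disjoint_left]
    intro z hz hz'
    rw [key] at hz hz'
    exact hij (hz.2.symm.trans hz'.2)
  · rintro i j hij u ⟨hu, rfl⟩ v ⟨hv, rfl⟩
    exact hA u hu v hv hij
  · rintro i j hij u ⟨hu, rfl⟩ v ⟨hv, rfl⟩
    exact hB u hu v hv hij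
  · intro i j hij u hu v hv huv
    rw [key] at hu hv
    obtain ⟨hu, rfl⟩ := hu
    obtain ⟨hv, rfl⟩ := hv
    exact (ho u hu v hv hij huv).imp (fun h => ⟨⟨h.1, rfl⟩, h.2, rfl⟩)
      fun h => ⟨⟨h.1, rfl⟩, h.2, rfl⟩
  · intro i w hw
    rw [key] at hw
    obtain ⟨hw, rfl⟩ := hw
    obtain ⟨u, hu, v, hv, n, s, p, hws, hi, hc⟩ := hr w hw
    obtain ⟨q, hq, -, hqs⟩ := p.exists_walk
    refine ⟨u, v, q, ⟨⟨hu, hc u p.fst_mem⟩, ⟨hv, hc v p.snd_mem⟩, hq, fun z hz => ?_⟩,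
      (hqs w).2 hws⟩
    rw [hqs] at hz
    exact (hi z hz).imp_right fun h => h.imp_right fun h => ⟨h, hc z hz⟩

end IsHyperprism

/-! ### Touched and untouched rungs, and the new hyperprism. -/

/-- Some `i`-rung has both ends adjacent to `x`. -/
def HasTouchedRung (G : SimpleGraph V) (A C B : Fin 3 → Set V) (x : V) (i : Fin 3) : Prop :=
  ∃ a b s, RungSet G A C B i a b s ∧ G.Adj x a ∧ G.Adj x b

/-- Some `i`-rung contains no neighbour of `x`. -/
def HasUntouchedRung (G : SimpleGraph V) (A C B : Fin 3 → Set V) (x : V) (i : Fin 3) : Prop :=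
  ∃ a b s, RungSet G A C B i a b s ∧ ∀ z ∈ s, ¬ G.Adj x z

theorem HasTouchedRung.reverse {i : Fin 3} (h : HasTouchedRung G A C B x i) :
    HasTouchedRung G B C A x i :=
  let ⟨a, b, s, r, ha, hb⟩ := h; ⟨b, a, s, r.reverse, hb, ha⟩

theorem HasUntouchedRung.reverse {i : Fin 3} (h : HasUntouchedRung G A C B x i) :
    HasUntouchedRung G B C A x i :=
  let ⟨a, b, s, r, h⟩ := h; ⟨b, a, s, r.reverse, h⟩

namespace IsEvenHyperprism

theorem evenPath (h : IsEvenHyperprism G S A C B) (hx : x ∉ S) {i : Fin 3} {a b : V} {s : Set V}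
    (r : RungSet G A C B i a b s) : EvenPath G x a b s where
  path := by
    obtain ⟨n, p⟩ := r.path
    obtain ⟨q, hq, hn, hs⟩ := p.exists_walk
    refine ⟨n, p, hn ▸ h.2 i a b q ⟨r.fst, r.snd, hq, fun z hz => ?_⟩⟩
    exact r.interior z ((hs z).1 hz)
  ne := by
    rintro rfl
    exact h.1.disjoint_AB' r.fst r.snd
  notMem hxs := hx (h.1.mem_of_strip (r.subset x hxs))

theorem symm (h : IsEvenHyperprism G S A C B) : IsEvenHyperprism G S B C A := by
  refine ⟨h.1.symm, fun i u v p ⟨hu, hv, hp, hi⟩ => ?_⟩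
  obtain ⟨q, hq, hn, hs⟩ := (IndPath.of_walk p hp).reverse.exists_walk
  rw [← hn]
  refine h.2 i v u q ⟨hv, hu, hq, fun z hz => ?_⟩
  have := hi z ((hs z).1 hz)
  tauto

/-- The three rungs form an even prism. If `x` misses one end of the `i`-rung, then in the triangle
at that end its only neighbour is on the touched rung, and `EvenPath.anticomplete_of_ends` applies,
read from that side. -/
theorem dichotomy (hB : ¬ ContainsOddHole G) (h : IsEvenHyperprism G S A C B) (hx : x ∉ S)
    {i j k : Fin 3} (hij : i ≠ j) (hik : i ≠ k) (hjk : j ≠ k)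
    (hj : HasTouchedRung G A C B x j) (hk : HasUntouchedRung G A C B x k)
    {a b : V} {s : Set V} (r : RungSet G A C B i a b s) :
    G.Adj x a ∧ G.Adj x b ∨ ∀ z ∈ s, ¬ G.Adj x z := by
  obtain ⟨a₁, b₁, s₁, r₁, ha₁, hb₁⟩ := hj
  obtain ⟨a₂, b₂, s₂, r₂, h₂⟩ := hk
  have l₁₂ := h.1.linked hjk r₁ r₂
  have l₁ := h.1.linked hij.symm r₁ r
  have l₂ := h.1.linked hik.symm r₂ r
  have e₁ := h.evenPath hx r₁
  have e₂ := h.evenPath hx r₂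
  have e := h.evenPath hx r
  by_cases ha : G.Adj x a
  · by_cases hb : G.Adj x b
    · exact Or.inl ⟨ha, hb⟩
    · exact Or.inr (e₁.reverse.anticomplete_of_ends hB e₂.reverse e.reverse l₁₂.reverse
        l₁.reverse l₂.reverse hb₁ ha₁ (h₂ _ r₂.snd_mem) hb)
  · exact Or.inr (e₁.anticomplete_of_ends hB e₂ e l₁₂ l₁ l₂ ha₁ hb₁ (h₂ _ r₂.fst_mem) ha)

/-- The situation created by exchanging one rung of an instance of which `x` is a major
neighbour. -/
theorem touched_and_untouched (hB : ¬ ContainsOddHole G) (h : IsEvenHyperprism G S A C B)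
    (hx : x ∉ S) {i j k : Fin 3} (hij : i ≠ j) (hik : i ≠ k) (hjk : j ≠ k)
    {a₁ b₁ a₂ b₂ a₃ b₃ a b : V} {s₁ s₂ s₃ s : Set V}
    (r₁ : RungSet G A C B i a₁ b₁ s₁) (r₂ : RungSet G A C B j a₂ b₂ s₂)
    (r₃ : RungSet G A C B k a₃ b₃ s₃) (r : RungSet G A C B i a b s)
    (ha₁ : G.Adj x a₁) (ha₂ : G.Adj x a₂) (ha₃ : ¬ G.Adj x a₃) (ha : ¬ G.Adj x a)
    (hb : G.Adj x b₁ ∧ G.Adj x b₂ ∨ G.Adj x b₁ ∧ G.Adj x b₃ ∨ G.Adj x b₂ ∧ G.Adj x b₃) :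
    (HasTouchedRung G A C B x i ∧ HasTouchedRung G A C B x j) ∧
      HasUntouchedRung G A C B x i ∧ HasUntouchedRung G A C B x k := by
  have e₁ := h.evenPath hx r₁
  have e₂ := h.evenPath hx r₂
  have e₃ := h.evenPath hx r₃
  have e := h.evenPath hx r
  have l₁ := h.1.linked hij.symm r₂ r
  have l₂ := h.1.linked hjk r₂ r₃
  have l₃ := h.1.linked hik r r₃
  by_cases hb₂ : G.Adj x b₂
  -- Both ends of the `j`-rung see `x`, so the other two rungs of the new instance are untouched. As
  -- `b₃` misses `x`, the vertex `b₁` sees it, and the discarded rung is touched.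
  · have h1 := e₂.anticomplete_of_ends hB e e₃ l₁ l₂ l₃ ha₂ hb₂ ha ha₃
    have h2 := e₂.anticomplete_of_ends hB e₃ e l₂ l₁ l₃.symm ha₂ hb₂ ha₃ ha
    have hb₃ := h1 b₃ r₃.snd_mem
    exact ⟨⟨⟨_, _, _, r₁, ha₁, by tauto⟩, ⟨_, _, _, r₂, ha₂, hb₂⟩⟩, ⟨_, _, _, r, h2⟩,
      ⟨_, _, _, r₃, h1⟩⟩
  · obtain ⟨hb₁, hb₃⟩ : G.Adj x b₁ ∧ G.Adj x b₃ := by tauto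
    have l := h.1.linked hik r₁ r₃
    exfalso
    -- The extra vertex is `b₁`, the `B`-end of the discarded rung; it may have arbitrary neighbours
    -- on the rung that replaces it.
    refine e₂.false_of_crossing hB e e₃ l₁ l₂ l₃ ha₂ ha ha₃ hb₂ hb₃ hb₁
      (h.1.complete_B i j hij _ r₁.snd _ r₂.snd) (fun h1 => h.1.not_adj_AB hij.symm r₂.fst r₁.snd
        h1.symm) (l.disj _ r₁.snd_mem) (fun z hz h1 => ?_) ?_
    · rcases l.only _ r₁.snd_mem z hz h1 with h2 | h2
      · exact absurd h2.1.symm e₁.ne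
      · exact h2.2
    · rintro rfl
      exact h.1.disjoint_AB' r₂.fst r₁.snd

/-- Any other contact would allow a recombined rung with one end from the touched rung and the other
from the untouched one. Such a rung has exactly one end adjacent to `x`, against `dichotomy`. -/
theorem ends_of_adj (hB : ¬ ContainsOddHole G) (h : IsEvenHyperprism G S A C B) (hx : x ∉ S)
    {i j k : Fin 3} (hij : i ≠ j) (hik : i ≠ k) (hjk : j ≠ k)
    (hj : HasTouchedRung G A C B x j) (hk : HasUntouchedRung G A C B x k)
    {a b a' b' u v : V} {s s' : Set V} (r : RungSet G A C B i a b s)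
    (r' : RungSet G A C B i a' b' s') (ha : G.Adj x a) (hb : G.Adj x b)
    (hs' : ∀ z ∈ s', ¬ G.Adj x z) (hu : u ∈ s) (hv : v ∈ s') (huv : u = v ∨ G.Adj u v) :
    u = a ∧ v = a' ∨ u = b ∧ v = b' := by
  have h1 : u = b ∨ v = a' := by
    by_contra! hcon
    obtain ⟨t, q⟩ := r.recombine r' hu hv huv hcon.1 hcon.2
    rcases h.dichotomy hB hx hij hik hjk hj hk q with h1 | h1
    · exact hs' _ r'.snd_mem h1.2
    · exact h1 _ q.fst_mem ha
  have h2 : u = a ∨ v = b' := by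
    by_contra! hcon
    obtain ⟨t, q⟩ := r.reverse.recombine r'.reverse hu hv huv hcon.1 hcon.2
    rcases h.dichotomy hB hx hij hik hjk hj hk q.reverse with h1 | h1
    · exact hs' _ r'.fst_mem h1.1
    · exact h1 _ q.fst_mem hb
  have h3 := (h.evenPath hx r).ne
  have h4 := (h.evenPath hx r').ne
  rcases h1 with rfl | rfl <;> rcases h2 with h2 | h2
  · exact absurd h2.symm h3
  · exact Or.inr ⟨rfl, h2⟩
  · exact Or.inl ⟨h2, rfl⟩
  · exact absurd h2 h4

/-- `EvenPath.adj_of_anticomplete` is applied to the prism formed by the touched `j`-rung, the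
untouched `i`-rung and the untouched `k`-rung, with the `A`-end of the touched `i`-rung as extra
vertex. -/
theorem adj_fst_of_touched (hB : ¬ ContainsOddHole G) (h : IsEvenHyperprism G S A C B) (hx : x ∉ S)
    {i j k : Fin 3} (hij : i ≠ j) (hik : i ≠ k) (hjk : j ≠ k)
    (hj : HasTouchedRung G A C B x j) (hk : HasUntouchedRung G A C B x k)
    {a b a' b' : V} {s s' : Set V} (r : RungSet G A C B i a b s)
    (r' : RungSet G A C B i a' b' s') (ha : G.Adj x a) (hb : G.Adj x b)
    (hs' : ∀ z ∈ s', ¬ G.Adj x z) : G.Adj a a' := by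
  have ends := fun v hv => h.ends_of_adj hB hx hij hik hjk hj hk r r' ha hb hs' (u := a) (v := v)
    r.fst_mem hv
  obtain ⟨a₁, b₁, s₁, r₁, ha₁, hb₁⟩ := hj
  obtain ⟨a₂, b₂, s₂, r₂, h₂⟩ := hk
  refine (h.evenPath hx r₁).adj_of_anticomplete hB (h.evenPath hx r') (h.evenPath hx r₂)
    (h.1.linked hij.symm r₁ r') (h.1.linked hjk r₁ r₂) (h.1.linked hik r' r₂) hb₁ hs' h₂ ha
    (h.1.complete_A i k hik _ r.fst _ r₂.fst) (h.1.not_adj_AB hij r.fst r₁.snd) ?_ ?_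
  · rintro rfl
    exact h.1.disjoint_AB' r.fst r₁.snd
  · intro z hz haz
    rcases ends z hz (Or.inr haz) with h1 | h1
    · exact h1.2
    · exact absurd h1.1 (h.evenPath hx r).ne

/-- If touched and untouched rungs are spread over the strips, then `x` can be added. -/
theorem inducesHyperprism (hB : ¬ ContainsOddHole G) (h : IsEvenHyperprism G S A C B) (hx : x ∉ S)
    {p q : Fin 3} (hpq : p ≠ q) (hp : HasUntouchedRung G A C B x p)
    (hq : HasUntouchedRung G A C B x q)
    (hall : ∀ i : Fin 3, ∃ j k, i ≠ j ∧ i ≠ k ∧ j ≠ k ∧ HasTouchedRung G A C B x j ∧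
      HasUntouchedRung G A C B x k) : InducesHyperprism G (S ∪ {x}) := by
  classical
  have dich : ∀ i a b s, RungSet G A C B i a b s →
      G.Adj x a ∧ G.Adj x b ∨ ∀ z ∈ s, ¬ G.Adj x z := by
    intro i a b s r
    obtain ⟨j, k, hij, hik, hjk, hj, hk⟩ := hall i
    exact h.dichotomy hB hx hij hik hjk hj hk r
  let M : Set V := {z | ∃ i a b s, RungSet G A C B i a b s ∧ z ∈ s ∧ G.Adj x a ∧ G.Adj x b}
  let L : Set V := {z | ∃ i a b s, RungSet G A C B i a b s ∧ z ∈ s ∧ ∀ z ∈ s, ¬ G.Adj x z}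
  have cover : ∀ z ∈ S, ∃ i, z ∈ A i ∪ B i ∪ C i := by
    intro z hz
    rw [h.1.cover] at hz
    exact Set.mem_iUnion.1 hz
  have hML : ∀ i, ∀ z ∈ A i ∪ B i ∪ C i, z ∈ M ∨ z ∈ L := by
    intro i z hz
    obtain ⟨a, b, s, r, hzs⟩ := h.1.exists_rungSet hz
    exact (dich i a b s r).imp (fun h => ⟨i, a, b, s, r, hzs, h⟩) fun h => ⟨i, a, b, s, r, hzs, h⟩
  have ends : ∀ i u v, u ∈ A i ∪ B i ∪ C i → v ∈ A i ∪ B i ∪ C i → u ∈ M → v ∈ L →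
      ∃ a ∈ A i, ∃ a' ∈ A i, ∃ b ∈ B i, ∃ b' ∈ B i, (G.Adj a a' ∧ G.Adj b b') ∧
        (u ∈ A i → u = a) ∧ (v ∈ A i → v = a') ∧ (u ∈ B i → u = b) ∧ (v ∈ B i → v = b') ∧
        (u = v ∨ G.Adj u v → u = a ∧ v = a' ∨ u = b ∧ v = b') := by
    rintro i u v hu hv ⟨i₁, a, b, s, r, hus, ha, hb⟩ ⟨i₂, a', b', s', r', hvs, hs'⟩
    obtain rfl := h.1.strip_eq hu (r.subset u hus)
    obtain rfl := h.1.strip_eq hv (r'.subset v hvs)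
    obtain ⟨j, k, hij, hik, hjk, hj, hk⟩ := hall i
    exact ⟨a, r.fst, a', r'.fst, b, r.snd, b', r'.snd,
      ⟨h.adj_fst_of_touched hB hx hij hik hjk hj hk r r' ha hb hs',
        h.symm.adj_fst_of_touched hB hx hij hik hjk hj.reverse hk.reverse r.reverse r'.reverse
          hb ha hs'⟩, h.1.eq_fst r hus, h.1.eq_fst r' hvs, h.1.eq_snd r hus, h.1.eq_snd r' hvs,
      h.ends_of_adj hB hx hij hik hjk hj hk r r' ha hb hs' hus hvs⟩
  -- A common vertex would be a common end of a touched and an untouched rung; but such ends are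
  -- adjacent, hence distinct.
  have hdisj : ∀ z ∈ L, z ∉ M := by
    rintro z hzL hzM
    obtain ⟨i, hz⟩ := cover z (by
      obtain ⟨i, a, b, s, r, hz, -⟩ := hzL
      exact h.1.mem_of_strip (r.subset z hz))
    obtain ⟨a, -, a', -, b, -, b', -, hab, -, -, -, -, h1⟩ := ends i z z hz hz hzM hzL
    rcases h1 (Or.inl rfl) with h2 | h2
    · exact hab.1.ne (h2.1.symm.trans h2.2)
    · exact hab.2.ne (h2.1.symm.trans h2.2)
  have hLx : ∀ z ∈ L, ¬ G.Adj x z ∧ z ≠ x := by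
    rintro z ⟨i, a, b, s, r, hz, hs⟩
    refine ⟨hs z hz, ?_⟩
    rintro rfl
    exact hx (h.1.mem_of_strip (r.subset z hz))
  -- Label 0 is the touched part with `x`; the untouched part is split into strip `q` (label 2) and
  -- the rest (label 1), which is non-empty because of strip `p`.
  let c : V → Fin 3 := fun z =>
    if z = x ∨ z ∈ M then 0 else if z ∈ A q ∪ B q ∪ C q then 2 else 1
  have cx : c x = 0 := if_pos (Or.inl rfl)
  have cM : ∀ z ∈ M, c z = 0 := fun z hz => if_pos (Or.inr hz)
  have cL : ∀ z ∈ L, c z = if z ∈ A q ∪ B q ∪ C q then 2 else 1 := fun z hz =>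
    if_neg (not_or.2 ⟨(hLx z hz).2, hdisj z hz⟩)
  have cstrip : ∀ i, ∀ z ∈ A i ∪ B i ∪ C i, z ∈ L → c z = if i = q then 2 else 1 := by
    intro i z hz hzL
    rw [cL z hzL]
    refine if_congr ⟨fun h1 => h.1.strip_eq hz h1, ?_⟩ rfl rfl
    rintro rfl
    exact hz
  have sep : ∀ i u v, u ∈ A i ∪ B i ∪ C i → v ∈ A i ∪ B i ∪ C i → c u ≠ c v →
      u ∈ M ∧ v ∈ L ∨ u ∈ L ∧ v ∈ M := by
    intro i u v hu hv huv
    rcases hML i u hu with h1 | h1 <;> rcases hML i v hv with h2 | h2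
    · exact absurd ((cM u h1).trans (cM v h2).symm) huv
    · exact Or.inl ⟨h1, h2⟩
    · exact Or.inr ⟨h1, h2⟩
    · exact absurd ((cstrip i u hu h1).trans (cstrip i v hv h2).symm) huv
  have touchedM : ∀ j, HasTouchedRung G A C B x j →
      ∃ a ∈ A j, ∃ b ∈ B j, a ∈ M ∧ b ∈ M ∧ G.Adj x a ∧ G.Adj x b := by
    rintro j ⟨a, b, s, r, ha, hb⟩
    exact ⟨a, r.fst, b, r.snd, ⟨j, a, b, s, r, r.fst_mem, ha, hb⟩,
      ⟨j, a, b, s, r, r.snd_mem, ha, hb⟩, ha, hb⟩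
  have untouchedL : ∀ j, HasUntouchedRung G A C B x j →
      ∃ a ∈ A j, ∃ b ∈ B j, a ∈ L ∧ b ∈ L := by
    rintro j ⟨a, b, s, r, hs⟩
    exact ⟨a, r.fst, b, r.snd, ⟨j, a, b, s, r, r.fst_mem, hs⟩, ⟨j, a, b, s, r, r.snd_mem, hs⟩⟩
  -- Applying `hall` to `m` itself produces a second strip `m' ≠ m` with a touched rung; both are
  -- needed for a rung through `x`.
  obtain ⟨m, -, -, -, -, hm, -⟩ := hall 0
  obtain ⟨m', -, hmm, -, -, hm', -⟩ := hall m
  obtain ⟨am, ham, bm, hbm, hamM, hbmM, xam, xbm⟩ := touchedM m hm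
  obtain ⟨am', ham', bm', hbm', hamM', hbmM', xam', xbm'⟩ := touchedM m' hm'
  obtain ⟨ap, hap, bp, hbp, hapL, hbpL⟩ := untouchedL p hp
  obtain ⟨aq, haq, bq, hbq, haqL, hbqL⟩ := untouchedL q hq
  have adjA : ∀ u ∈ ⋃ i, A i, ∀ v ∈ ⋃ i, A i, c u ≠ c v → G.Adj u v := by
    intro u hu v hv huv
    obtain ⟨i, hu⟩ := Set.mem_iUnion.1 hu
    obtain ⟨j, hv⟩ := Set.mem_iUnion.1 hv
    by_cases hij : i = j
    · subst hij
      rcases sep i u v (Or.inl (Or.inl hu)) (Or.inl (Or.inl hv)) huv with h1 | h1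
      · obtain ⟨a, -, a', -, b, -, b', -, hab, h2, h3, -⟩ :=
          ends i u v (Or.inl (Or.inl hu)) (Or.inl (Or.inl hv)) h1.1 h1.2
        rw [h2 hu, h3 hv]
        exact hab.1
      · obtain ⟨a, -, a', -, b, -, b', -, hab, h2, h3, -⟩ :=
          ends i v u (Or.inl (Or.inl hv)) (Or.inl (Or.inl hu)) h1.2 h1.1
        rw [h2 hv, h3 hu]
        exact hab.1.symm
    · exact h.1.complete_A i j hij u hu v hv
  have adjB : ∀ u ∈ ⋃ i, B i, ∀ v ∈ ⋃ i, B i, c u ≠ c v → G.Adj u v := by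
    intro u hu v hv huv
    obtain ⟨i, hu⟩ := Set.mem_iUnion.1 hu
    obtain ⟨j, hv⟩ := Set.mem_iUnion.1 hv
    by_cases hij : i = j
    · subst hij
      rcases sep i u v (Or.inl (Or.inr hu)) (Or.inl (Or.inr hv)) huv with h1 | h1
      · obtain ⟨a, -, a', -, b, -, b', -, hab, -, -, h2, h3, -⟩ :=
          ends i u v (Or.inl (Or.inr hu)) (Or.inl (Or.inr hv)) h1.1 h1.2
        rw [h2 hu, h3 hv]
        exact hab.2
      · obtain ⟨a, -, a', -, b, -, b', -, hab, -, -, h2, h3, -⟩ :=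
          ends i v u (Or.inl (Or.inr hv)) (Or.inl (Or.inr hu)) h1.2 h1.1
        rw [h2 hv, h3 hu]
        exact hab.2.symm
    · exact h.1.complete_B i j hij u hu v hv
  have only : ∀ u ∈ S, ∀ v ∈ S, c u ≠ c v → G.Adj u v →
      (u ∈ ⋃ i, A i) ∧ (v ∈ ⋃ i, A i) ∨ (u ∈ ⋃ i, B i) ∧ (v ∈ ⋃ i, B i) := by
    intro u hu v hv huv hadj
    obtain ⟨i, hu⟩ := cover u hu
    obtain ⟨j, hv⟩ := cover v hv
    have inA : ∀ {k z}, z ∈ A k → z ∈ ⋃ i, A i := fun h => Set.mem_iUnion.2 ⟨_, h⟩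
    have inB : ∀ {k z}, z ∈ B k → z ∈ ⋃ i, B i := fun h => Set.mem_iUnion.2 ⟨_, h⟩
    by_cases hij : i = j
    · subst hij
      rcases sep i u v hu hv huv with h1 | h1
      · obtain ⟨a, ha, a', ha', b, hb, b', hb', -, -, -, -, -, h2⟩ := ends i u v hu hv h1.1 h1.2
        rcases h2 (Or.inr hadj) with ⟨rfl, rfl⟩ | ⟨rfl, rfl⟩
        · exact Or.inl ⟨inA ha, inA ha'⟩
        · exact Or.inr ⟨inB hb, inB hb'⟩
      · obtain ⟨a, ha, a', ha', b, hb, b', hb', -, -, -, -, -, h2⟩ := ends i v u hv hu h1.2 h1.1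
        rcases h2 (Or.inr hadj.symm) with ⟨rfl, rfl⟩ | ⟨rfl, rfl⟩
        · exact Or.inl ⟨inA ha', inA ha⟩
        · exact Or.inr ⟨inB hb', inB hb⟩
    · exact (h.1.only i j hij u hu v hv hadj).imp (fun h => ⟨inA h.1, inA h.2⟩)
        fun h => ⟨inB h.1, inB h.2⟩
  have label_x : ∀ v ∈ S, c x ≠ c v → ¬ G.Adj x v := by
    intro v hv hcv
    obtain ⟨i, hv⟩ := cover v hv
    rcases hML i v hv with h1 | h1
    · exact absurd (cx.trans (cM v h1).symm) hcv
    · exact (hLx v h1).1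
  have memS : ∀ {i z}, z ∈ A i ∪ B i ∪ C i → z ∈ S := h.1.mem_of_strip
  -- Ends remain ends and interiors remain interiors, with `x` joining the interiors; only the
  -- grouping into strips changes.
  refine ⟨_, _, _, IsHyperprism.of_label (𝒜 := ⋃ i, A i) (ℬ := ⋃ i, B i)
    (𝒞 := (⋃ i, C i) ∪ {x}) c ?_ ?_ ?_ ?_ ?_ ?_ adjA adjB ?_ ?_⟩
  · rw [h.1.cover, Set.iUnion_union_distrib, Set.iUnion_union_distrib, Set.union_assoc _ _ {x}]
  · rw [Set.disjoint_left]
    intro z hz hz'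
    obtain ⟨i, hz⟩ := Set.mem_iUnion.1 hz
    obtain ⟨j, hz'⟩ := Set.mem_iUnion.1 hz'
    exact h.1.disjoint_AB' hz hz'
  · rw [Set.disjoint_left]
    rintro z hz (hz' | rfl)
    · obtain ⟨i, hz⟩ := Set.mem_iUnion.1 hz
      obtain ⟨j, hz'⟩ := Set.mem_iUnion.1 hz'
      exact h.1.disjoint_AC' hz hz'
    · obtain ⟨i, hz⟩ := Set.mem_iUnion.1 hz
      exact hx (memS (Or.inl (Or.inl hz)))
  · rw [Set.disjoint_left]
    rintro z hz (hz' | rfl)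
    · obtain ⟨i, hz⟩ := Set.mem_iUnion.1 hz
      obtain ⟨j, hz'⟩ := Set.mem_iUnion.1 hz'
      exact h.1.symm.disjoint_AC' hz hz'
    · obtain ⟨i, hz⟩ := Set.mem_iUnion.1 hz
      exact hx (memS (Or.inl (Or.inr hz)))
  · intro i
    fin_cases i
    · exact ⟨am, Set.mem_iUnion.2 ⟨m, ham⟩, cM _ hamM⟩
    · exact ⟨ap, Set.mem_iUnion.2 ⟨p, hap⟩,
        (cstrip p ap (Or.inl (Or.inl hap)) hapL).trans (if_neg hpq)⟩
    · exact ⟨aq, Set.mem_iUnion.2 ⟨q, haq⟩,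
        (cstrip q aq (Or.inl (Or.inl haq)) haqL).trans (if_pos rfl)⟩
  · intro i
    fin_cases i
    · exact ⟨bm, Set.mem_iUnion.2 ⟨m, hbm⟩, cM _ hbmM⟩
    · exact ⟨bp, Set.mem_iUnion.2 ⟨p, hbp⟩,
        (cstrip p bp (Or.inl (Or.inr hbp)) hbpL).trans (if_neg hpq)⟩
    · exact ⟨bq, Set.mem_iUnion.2 ⟨q, hbq⟩,
        (cstrip q bq (Or.inl (Or.inr hbq)) hbqL).trans (if_pos rfl)⟩
  · rintro u (hu | rfl) v (hv | rfl) huv hadj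
    · exact only u hu v hv huv hadj
    · exact absurd hadj.symm (label_x u hu huv.symm)
    · exact absurd hadj (label_x v hv huv)
    · exact absurd rfl huv
  · rintro w (hw | rfl)
    · obtain ⟨i, hw⟩ := cover w hw
      obtain ⟨a, b, s, r, hws⟩ := h.1.exists_rungSet hw
      obtain ⟨n, P⟩ := r.path
      refine ⟨a, Set.mem_iUnion.2 ⟨i, r.fst⟩, b, Set.mem_iUnion.2 ⟨i, r.snd⟩, n, s, P, hws,
        fun z hz => (r.interior z hz).imp_right fun h => h.imp_right fun h =>
          Or.inl (Set.mem_iUnion.2 ⟨i, h⟩), fun z hz => ?_⟩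
      rcases dich i a b s r with h1 | h1
      · rw [cM z ⟨i, a, b, s, r, hz, h1⟩, cM w ⟨i, a, b, s, r, hws, h1⟩]
      · rw [cstrip i z (r.subset z hz) ⟨i, a, b, s, r, hz, h1⟩,
          cstrip i w hw ⟨i, a, b, s, r, hws, h1⟩]
    -- The rung through `x` is `am`–`x`–`bm'`. Its ends are taken from different old strips, which
    -- makes them non-adjacent.
    · have hne : am ≠ bm' := by
        rintro rfl
        exact h.1.disjoint_AB' ham hbm'
      have P := ((IndPath.single (G := G) bm').cons xbm' (fun h => xbm'.ne h)
        (fun z hz _ => hz)).cons xam.symm (by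
          rintro (h | h)
          · exact xam.ne h.symm
          · exact hne h) (by
          rintro z (hz | rfl) h1
          · exact hz
          · exact absurd h1 (h.1.not_adj_AB hmm ham hbm'))
      refine ⟨am, Set.mem_iUnion.2 ⟨m, ham⟩, bm', Set.mem_iUnion.2 ⟨m', hbm'⟩, _, _, P,
        Or.inr (Or.inl rfl), ?_, ?_⟩
      · rintro z (hz | hz | hz)
        · exact Or.inl hz
        · exact Or.inr (Or.inr (Or.inr hz))
        · exact Or.inr (Or.inl hz)
      · rintro z (rfl | rfl | hz)
        · rw [cM _ hamM, cx]
        · rfl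
        · rw [show z = bm' from hz, cM _ hbmM', cx]

end IsEvenHyperprism

/-! ### Exchanging rungs in an instance. -/

theorem exists_third_index : ∀ p j : Fin 3, p ≠ j →
    ∃ k, p ≠ k ∧ j ≠ k ∧ ∀ l, l = p ∨ l = j ∨ l = k := by
  decide

/-- If exchanging one rung of an instance destroys the property that `x` has two neighbours in the
first triangle, then `x` can be added to the hyperprism. -/
theorem InducesHyperprism.of_exchange (hB : ¬ ContainsOddHole G)
    (h : IsEvenHyperprism G S A C B) (hx : x ∉ S) {a b : Fin 3 → V}
    (hr : ∀ i, ∃ s, RungSet G A C B i (a i) (b i) s) {p : Fin 3} {a' b' : V} {s' : Set V}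
    (r' : RungSet G A C B p a' b' s') (ha : ∃ i j, i ≠ j ∧ G.Adj x (a i) ∧ G.Adj x (a j))
    (hb : ∃ i j, i ≠ j ∧ G.Adj x (b i) ∧ G.Adj x (b j))
    (hn : ¬ ∃ i j, i ≠ j ∧ G.Adj x (Function.update a p a' i) ∧
      G.Adj x (Function.update a p a' j)) : InducesHyperprism G (S ∪ {x}) := by
  -- Two neighbours of `x` outside strip `p` would survive the exchange, so `a p` is one of the
  -- pair.
  obtain ⟨j, hpj, hap, haj⟩ : ∃ j, p ≠ j ∧ G.Adj x (a p) ∧ G.Adj x (a j) := by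
    obtain ⟨i, j, hij, hi, hj⟩ := ha
    by_cases h1 : i = p
    · exact ⟨j, h1 ▸ hij, h1 ▸ hi, hj⟩
    · by_cases h2 : j = p
      · exact ⟨i, Ne.symm h1, h2 ▸ hj, hi⟩
      · exact absurd ⟨i, j, hij, by rwa [Function.update_of_ne h1],
          by rwa [Function.update_of_ne h2]⟩ hn
  obtain ⟨k, hpk, hjk, hall⟩ : ∃ k, p ≠ k ∧ j ≠ k ∧ ∀ l, l = p ∨ l = j ∨ l = k :=
    exists_third_index p j hpj
  have ha' : ¬ G.Adj x a' := fun h1 => hn ⟨p, j, hpj, by rwa [Function.update_self],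
    by rwa [Function.update_of_ne hpj.symm]⟩
  have hak : ¬ G.Adj x (a k) := fun h1 => hn ⟨j, k, hjk, by rwa [Function.update_of_ne hpj.symm],
    by rwa [Function.update_of_ne hpk.symm]⟩
  have hb' : G.Adj x (b p) ∧ G.Adj x (b j) ∨ G.Adj x (b p) ∧ G.Adj x (b k) ∨
      G.Adj x (b j) ∧ G.Adj x (b k) := by
    obtain ⟨l, m, hlm, hl, hm⟩ := hb
    rcases hall l with rfl | rfl | rfl <;> rcases hall m with rfl | rfl | rfl <;> tauto
  obtain ⟨s₁, r₁⟩ := hr p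
  obtain ⟨s₂, r₂⟩ := hr j
  obtain ⟨s₃, r₃⟩ := hr k
  obtain ⟨⟨h1, h2⟩, h3, h4⟩ :=
    h.touched_and_untouched hB hx hpj hpk hjk r₁ r₂ r₃ r' hap haj hak ha' hb'
  refine h.inducesHyperprism hB hx hpk h3 h4 fun l => ?_
  rcases hall l with rfl | rfl | rfl
  · exact ⟨j, k, hpj, hpk, hjk, h2, h4⟩
  · exact ⟨p, k, hpj.symm, hjk, hpk, h1, h4⟩
  · exact ⟨j, p, hjk.symm, hpk.symm, hpj.symm, h2, h3⟩

/-- Rungs with `A`-end missing `x` are exchanged into the instance in two strips, one at a time. If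
the first exchange leaves two neighbours of `x` in both triangles, the second must fail on the `A`
side, so `of_exchange` applies to one of them. -/
theorem InducesHyperprism.of_not_complete (hB : ¬ ContainsOddHole G)
    (h : IsEvenHyperprism G S A C B) (hx : x ∉ S) {a b : Fin 3 → V}
    (hr : ∀ i, ∃ s, RungSet G A C B i (a i) (b i) s)
    (ha : ∃ i j, i ≠ j ∧ G.Adj x (a i) ∧ G.Adj x (a j))
    (hb : ∃ i j, i ≠ j ∧ G.Adj x (b i) ∧ G.Adj x (b j))
    (hn : ¬ ∃ i j, i ≠ j ∧ IsCompleteTo G x (A i) ∧ IsCompleteTo G x (A j)) :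
    InducesHyperprism G (S ∪ {x}) := by
  have key : ∀ i, ¬ IsCompleteTo G x (A i) → ∃ a b s, RungSet G A C B i a b s ∧ ¬ G.Adj x a := by
    intro i hi
    simp only [IsCompleteTo, not_forall] at hi
    obtain ⟨z, hz, hxz⟩ := hi
    obtain ⟨a, b, s, r, hzs⟩ := h.1.exists_rungSet (Or.inl (Or.inl hz))
    exact ⟨a, b, s, r, h.1.eq_fst r hzs hz ▸ hxz⟩
  obtain ⟨p, q, hpq, hp, hq⟩ : ∃ p q, p ≠ q ∧ ¬ IsCompleteTo G x (A p) ∧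
      ¬ IsCompleteTo G x (A q) := by
    by_contra hcon
    push Not at hcon hn
    by_cases h0 : IsCompleteTo G x (A 0)
    · exact hn 0 2 (by decide) h0 (hcon 1 2 (by decide) (hn 0 1 (by decide) h0))
    · exact hn 1 2 (by decide) (hcon 0 1 (by decide) h0) (hcon 0 2 (by decide) h0)
  obtain ⟨ap, bp, sp, rp, hap⟩ := key p hp
  obtain ⟨aq, bq, sq, rq, haq⟩ := key q hq
  have hr' : ∀ i, ∃ s, RungSet G A C B i (Function.update a p ap i)
      (Function.update b p bp i) s := by
    intro i
    by_cases hi : i = p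
    · subst hi
      rw [Function.update_self, Function.update_self]
      exact ⟨sp, rp⟩
    · rw [Function.update_of_ne hi, Function.update_of_ne hi]
      exact hr i
  by_cases ha1 : ∃ i j, i ≠ j ∧ G.Adj x (Function.update a p ap i) ∧
      G.Adj x (Function.update a p ap j)
  swap
  · exact .of_exchange hB h hx hr rp ha hb ha1
  by_cases hb1 : ∃ i j, i ≠ j ∧ G.Adj x (Function.update b p bp i) ∧
      G.Adj x (Function.update b p bp j)
  swap
  -- The first exchange may spoil the other triangle instead; this is the same situation with `A`
  -- and `B` swapped.
  · exact .of_exchange hB h.symm hx (fun i => (hr i).imp fun _ r => r.reverse) rp.reverse hb ha hb1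
  refine .of_exchange hB h hx hr' rq ha1 hb1 ?_
  rintro ⟨i, j, hij, hi, hj⟩
  -- After both exchanges, the third strip alone can contribute a neighbour of `x` to the first
  -- triangle.
  have hnadj : ∀ l, G.Adj x (Function.update (Function.update a p ap) q aq l) →
      l ≠ p ∧ l ≠ q := by
    intro l hl
    by_cases h1 : l = q
    · subst h1
      rw [Function.update_self] at hl
      exact absurd hl haq
    · rw [Function.update_of_ne h1] at hl
      refine ⟨?_, h1⟩
      rintro rfl
      rw [Function.update_self] at hl
      exact hap hl
  have hi := hnadj i hi
  have hj := hnadj j hj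
  omega

end EvenHyperprism

/-- The proof uses only that `G` has no odd hole; the absence of odd antiholes and the hypotheses
`hPrism` and `hK4` are not needed for this conclusion. -/
theorem mainTheorem7 {V : Type*} (G : SimpleGraph V)
    (hBerge : EvenHyperprism.IsBerge G)
    (hPrism : EvenHyperprism.ContainsEvenPrism G)
    (hK4 : ¬ EvenHyperprism.ContainsLineGraphOfBipartiteSubdivisionK4 G)
    (S : Set V) (A C B : Fin 3 → Set V)
    (hH : EvenHyperprism.IsEvenHyperprism G S A C B)
    (x : V) (hx : EvenHyperprism.IsMajorNeighborOfHyperprism G S A C B x) :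
    ((∃ i j, i ≠ j ∧ EvenHyperprism.IsCompleteTo G x (A i) ∧
          EvenHyperprism.IsCompleteTo G x (A j)) ∧
        (∃ i j, i ≠ j ∧ EvenHyperprism.IsCompleteTo G x (B i) ∧
          EvenHyperprism.IsCompleteTo G x (B j))) ∨
      EvenHyperprism.InducesHyperprism G (S ∪ {x}) := by
  obtain ⟨hxS, a, b, R, hR, -, ha, hb⟩ := hx
  have hr : ∀ i, ∃ s, EvenHyperprism.RungSet G A C B i (a i) (b i) s := fun i =>
    ⟨_, (hR i).1, (hR i).2.1, ⟨_, EvenHyperprism.IndPath.of_walk _ (hR i).2.2.1⟩, (hR i).2.2.2⟩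
  by_cases hA : ∃ i j, i ≠ j ∧ EvenHyperprism.IsCompleteTo G x (A i) ∧
      EvenHyperprism.IsCompleteTo G x (A j)
  · by_cases hB : ∃ i j, i ≠ j ∧ EvenHyperprism.IsCompleteTo G x (B i) ∧
        EvenHyperprism.IsCompleteTo G x (B j)
    · exact Or.inl ⟨hA, hB⟩
    · exact Or.inr (.of_not_complete hBerge.1 hH.symm hxS
        (fun i => (hr i).imp fun _ r => r.reverse) hb ha hB)
  · exact Or.inr (.of_not_complete hBerge.1 hH hxS hr ha hb hA)
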